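/- Let $d\ge 1$, $\alpha\in(0,2)$, and for $t>0$, $x\in\mathbb R^d$ let $p_t(x)=(2\pi)^{-d}\int_{\mathbb R^d}e^{i x\cdot u}e^{-t|u|^\alpha}\,du$; for $s<t$ and $x,y\in\mathbb R^d$ let $p(s,x,t,y)=p_{t-s}(y-x)$ be the transition density of the isotropic $\alpha$-stable Lévy process in $\mathbb R^d$. For a nonnegative jointly Borel function $j$ on $\mathbb R^d\times\mathbb R^d$ put $$\|j\|=\Big(\sup_{z}\int_{\mathbb R^d}j(z,w)\,dw\Big)\vee\Big(\sup_{w}\int_{\mathbb R^d}j(z,w)\,dz\Big).$$ There are constants $C_1,C_2\in(0,\infty)$ depending only on $d$ and $\alpha$ such that the following holds. Let $\varepsilon>0$ be so small that $\eta:=C_1 3^{d+\alpha}\varepsilon<1$, and let $j\ge 0$ be jointly Borel with $\|j\|<\infty$ and $j(z,w)\le\varepsilon|w-z|^{-d-\alpha}$ for all $z,w\in\mathbb R^d$ (the right-hand side being $+\infty$ when $z=w$). Then, with $\eta\in[0,1)$ as above and $c:=C_2\|j\|<\infty$, $$\int_s^t\int_{\mathbb R^d}\int_{\mathbb R^d}p(s,x,u,z)\,j(z,w)\,p(u,w,t,y)\,dw\,dz\,du\le[\eta+c(t-s)]\,p(s,x,t,y)$$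 for all $s<t$ and $x,y\in\mathbb R^d$. -/

import Mathlib

open MeasureTheory
open scoped ENNReal

namespace StableKernel

/-- The density `p_t(x) = (2π)^{-d} ∫ e^{i x·u} e^{-t|u|^α} du` of the isotropic `α`-stable
convolution semigroup on `ℝ^d`. The integral is a real number (the imaginary part vanishes by
the symmetry `u ↦ -u`), so taking its real part only changes the type. -/
noncomputable def stableDensity (d : ℕ) (α t : ℝ) (x : EuclideanSpace ℝ (Fin d)) : ℝ :=
  ((2 * Real.pi) ^ d)⁻¹ *
    (∫ u : EuclideanSpace ℝ (Fin d),
      Complex.exp (Complex.I * ((inner ℝ x u : ℝ) : ℂ)) *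
        ((Real.exp (-t * ‖u‖ ^ α) : ℝ) : ℂ)).re

/-- The transition density `p(s, x, t, y) = p_{t-s}(y - x)`, for `s < t`. -/
noncomputable def transitionDensity (d : ℕ) (α s : ℝ) (x : EuclideanSpace ℝ (Fin d))
    (t : ℝ) (y : EuclideanSpace ℝ (Fin d)) : ℝ :=
  stableDensity d α (t - s) (y - x)

/-- `‖j‖ = (sup_z ∫ j(z,w) dw) ∨ (sup_w ∫ j(z,w) dz)` for a nonnegative kernel `j`. -/
noncomputable def kernelNorm (d : ℕ)
    (j : EuclideanSpace ℝ (Fin d) → EuclideanSpace ℝ (Fin d) → ℝ≥0∞) : ℝ≥0∞ :=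
  max (⨆ z, ∫⁻ w, j z w) (⨆ w, ∫⁻ z, j z w)

end StableKernel

/-! The estimate rests on the two-sided comparison of `p_t(x)` with `t^{-d/α} ∧ t|x|^{-d-α}`
(`exists_stableBounds`). Split the path from `x` to `y` into `x → z`, the jump `z → w`, and `w → y`.
Either one of the two densities is at most a constant times `p(s,x,t,y)`, or the jump is at least
`|y-x|/3` long (`StableBounds.trichotomy`). In the first case, that factor comes out and `‖j‖`
controls what remains; integrating over time gives the term `c(t-s)`. In the second, the pointwise
bound on `j` gives a multiple of `ε p(s,x,t,y)/(t-s)`, whose time integral is the term `η`.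

The comparison is proved by subordination without constructing the stable subordinator. With `β =
α/2`, the symbol `exp(-|u|^α)` is a limit of Laplace transforms, evaluated at `|u|²`, of laws of
normalised Pareto sums plus a small drift. Each such symbol has a Gaussian mixture as cosine
transform, and inequalities for a single Gaussian integrate to bounds that involve the mixing law
only through its Laplace transform (`MixtureBounds`). Those bounds survive pointwise limits
(`MixtureBounds.of_tendsto`), hence hold for the stable symbol (`mixtureBounds_stable`). -/

namespace StableKernel

open Filter Topology

/-! ### Cosine transforms and the Gaussian kernel. -/

/-- The normalised cosine transform of a real symbol on `ℝ^d`. -/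
noncomputable def cosTransform {d : ℕ} (ρ : EuclideanSpace ℝ (Fin d) → ℝ)
    (x : EuclideanSpace ℝ (Fin d)) : ℝ :=
  ((2 * Real.pi) ^ d)⁻¹ * ∫ u, Real.cos (inner ℝ x u) * ρ u

/-- The Gaussian profile `s^{-d/2} e^{-r²/(4s)}`. -/
noncomputable def heatProfile (d : ℕ) (s r : ℝ) : ℝ :=
  s ^ (-((d : ℝ) / 2)) * Real.exp (-r ^ 2 / (4 * s))

/-- The constant `(2π)^{-d} π^{d/2}` normalising the Gaussian profile. -/
noncomputable def heatConst (d : ℕ) : ℝ := ((2 * Real.pi) ^ d)⁻¹ * Real.pi ^ ((d : ℝ) / 2)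

lemma heatConst_pos (d : ℕ) : 0 < heatConst d := by
  unfold heatConst
  have := Real.pi_pos
  positivity

lemma re_integral_cexp_mul {d : ℕ} {ρ : EuclideanSpace ℝ (Fin d) → ℝ} (hρ : Integrable ρ)
    (x : EuclideanSpace ℝ (Fin d)) :
    (∫ u, Complex.exp (Complex.I * ((inner ℝ x u : ℝ) : ℂ)) * ((ρ u : ℝ) : ℂ)).re =
      ∫ u, Real.cos (inner ℝ x u) * ρ u := by
  have hint : Integrable (fun u => Complex.exp (Complex.I * ((inner ℝ x u : ℝ) : ℂ)) *
      ((ρ u : ℝ) : ℂ)) := by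
    refine hρ.ofReal.bdd_mul (c := 1) (by fun_prop) ?_
    exact Eventually.of_forall fun u => by
      rw [mul_comm, Complex.norm_exp_ofReal_mul_I]
  have := integral_re hint
  simp only [RCLike.re_eq_complex_re] at this
  rw [← this]
  refine integral_congr_ae (Eventually.of_forall fun u => ?_)
  simp only [Complex.re_mul_ofReal]
  rw [mul_comm Complex.I, Complex.exp_ofReal_mul_I_re]

lemma integrable_exp_neg_mul_sq {d : ℕ} {s : ℝ} (hs : 0 < s) :
    Integrable (fun u : EuclideanSpace ℝ (Fin d) => Real.exp (-s * ‖u‖ ^ 2)) := by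
  have h := (GaussianFourier.integrable_cexp_neg_mul_sq_norm_add (b := (s : ℂ))
    (by simpa using hs) 0 (0 : EuclideanSpace ℝ (Fin d))).re
  refine h.congr (Eventually.of_forall fun u => ?_)
  simp only [zero_mul, add_zero, RCLike.re_eq_complex_re]
  rw [← Complex.exp_ofReal_re]
  push_cast
  rfl

lemma cosTransform_gaussian {d : ℕ} {s : ℝ} (hs : 0 < s) (x : EuclideanSpace ℝ (Fin d)) :
    cosTransform (fun u => Real.exp (-s * ‖u‖ ^ 2)) x = heatConst d * heatProfile d s ‖x‖ := by
  have h := GaussianFourier.integral_cexp_neg_mul_sq_norm_add (b := (s : ℂ))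
    (by simpa using hs) Complex.I x
  have h2 := re_integral_cexp_mul (integrable_exp_neg_mul_sq hs) x
  have e : ∀ u : EuclideanSpace ℝ (Fin d),
      Complex.exp (Complex.I * ((inner ℝ x u : ℝ) : ℂ)) *
        ((Real.exp (-s * ‖u‖ ^ 2) : ℝ) : ℂ) =
      Complex.exp (-(s : ℂ) * (‖u‖ : ℂ) ^ 2 + Complex.I * ((inner ℝ x u : ℝ) : ℂ)) := by
    intro u
    rw [Complex.exp_add, mul_comm]
    push_cast
    rfl
  simp only [e] at h2
  rw [h] at h2
  unfold cosTransform heatConst heatProfile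
  rw [← h2]
  have hpi := Real.pi_pos
  have e2 : ((Real.pi : ℂ) / s) ^ (((Module.finrank ℝ (EuclideanSpace ℝ (Fin d)) : ℕ) : ℂ) / 2) *
      Complex.exp (Complex.I ^ 2 * (‖x‖ : ℂ) ^ 2 / (4 * s)) =
      (((Real.pi / s) ^ ((d : ℝ) / 2) * Real.exp (-‖x‖ ^ 2 / (4 * s)) : ℝ) : ℂ) := by
    rw [Complex.ofReal_mul, Complex.ofReal_cpow (by positivity)]
    push_cast
    simp
  rw [e2, Complex.ofReal_re, Real.div_rpow hpi.le hs.le, Real.rpow_neg hs.le]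
  ring

lemma heatProfile_nonneg (d : ℕ) {s : ℝ} (hs : 0 ≤ s) (r : ℝ) : 0 ≤ heatProfile d s r := by
  unfold heatProfile; positivity

lemma heatProfile_scale (d : ℕ) {s r : ℝ} (hs : 0 < s) (hr : 0 < r) :
    heatProfile d s r = r ^ (-(d : ℝ)) * heatProfile d (s * r ^ (-2 : ℝ)) 1 := by
  unfold heatProfile
  rw [Real.mul_rpow hs.le (by positivity), ← Real.rpow_mul hr.le]
  have : (-2 : ℝ) * -((d : ℝ) / 2) = d := by ring
  rw [this, Real.rpow_neg hr.le, Real.rpow_neg hr.le]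
  have h2 : r ^ (2 : ℝ) = r ^ 2 := by norm_cast
  rw [h2]
  have hrd : r ^ (d : ℝ) ≠ 0 := by positivity
  have : -r ^ 2 / (4 * s) = -1 ^ 2 / (4 * (s * (r ^ 2)⁻¹)) := by field_simp
  rw [this]
  field_simp

lemma heatProfile_antitone (d : ℕ) {s r r' : ℝ} (hs : 0 < s) (hr : 0 ≤ r) (h : r ≤ r') :
    heatProfile d s r' ≤ heatProfile d s r := by
  unfold heatProfile
  gcongr

/-! ### The Gaussian profile compared with combinations of `1 - e^{-kσ}`. -/

lemma half_le_one_sub_exp_neg {x : ℝ} (h0 : 0 ≤ x) (h1 : x ≤ 1) :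
    x / 2 ≤ 1 - Real.exp (-x) := by
  have h := Real.add_one_le_exp x
  have h2 : Real.exp (-x) ≤ 1 / (1 + x) := by
    rw [Real.exp_neg, ← one_div]
    exact one_div_le_one_div_of_le (by linarith) (by linarith)
  have h3 : 1 / (1 + x) ≤ 1 - x / 2 := by
    rw [div_le_iff₀ (by linarith)]
    nlinarith
  linarith

lemma one_sub_exp_neg_le (x : ℝ) : 1 - Real.exp (-x) ≤ x := by
  have := Real.add_one_le_exp (-x)
  linarith

/-- Near zero the factor `e^{-1/(4σ)}` beats every power of `σ`; for `σ ≥ 1` the profile is at most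
`1` and the right side is bounded below. The function `1 - e^{-σ}` is chosen because its average
over a mixing law is a value of the Laplace transform. -/
lemma exists_heatProfile_le (d : ℕ) :
    ∃ C : ℝ, 0 < C ∧ ∀ σ : ℝ, 0 < σ → heatProfile d σ 1 ≤ C * (1 - Real.exp (-σ)) := by
  refine ⟨2 * (4 ^ (d + 1) * (d + 1).factorial), by positivity, fun σ hσ => ?_⟩
  have hC : (1 : ℝ) ≤ 4 ^ (d + 1) * (d + 1).factorial := by
    have h1 : (1 : ℝ) ≤ 4 ^ (d + 1) := one_le_pow₀ (by norm_num)
    have h2 : (1 : ℝ) ≤ (d + 1).factorial := by exact_mod_cast (d + 1).factorial_pos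
    nlinarith
  set C : ℝ := 4 ^ (d + 1) * (d + 1).factorial with hCdef
  rcases le_total 1 σ with h | h
  · have h1 : heatProfile d σ 1 ≤ 1 := by
      unfold heatProfile
      refine mul_le_one₀ (Real.rpow_le_one_of_one_le_of_nonpos h ?_) (by positivity) ?_
      · have : (0 : ℝ) ≤ d := by positivity
        linarith
      · rw [Real.exp_le_one_iff]
        have : 0 < 4 * σ := by linarith
        rw [div_le_iff₀ this]; norm_num
    have h2 := half_le_one_sub_exp_neg (x := 1) (by norm_num) le_rfl
    have h3 : Real.exp (-σ) ≤ Real.exp (-1) := Real.exp_le_exp.2 (by linarith)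
    nlinarith
  · have h2 := half_le_one_sub_exp_neg hσ.le h
    -- The exponent `d + 1` leaves one power of `σ` after the crude bound `σ^{-d/2} ≤ σ^{-d}`.
    have h3 := Real.pow_div_factorial_le_exp (x := 1 / (4 * σ)) (by positivity) (d + 1)
    have h4 : heatProfile d σ 1 ≤ C * σ := by
      unfold heatProfile
      have e1 : Real.exp (-1 ^ 2 / (4 * σ)) = (Real.exp (1 / (4 * σ)))⁻¹ := by
        rw [← Real.exp_neg]; congr 1; ring
      have e2 : (Real.exp (1 / (4 * σ)))⁻¹ ≤ C * σ ^ (d + 1) := by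
        rw [inv_le_comm₀ (Real.exp_pos _) (by positivity)]
        refine le_trans (le_of_eq ?_) h3
        rw [hCdef, div_pow, mul_pow, one_pow]
        field_simp
      have e3 : σ ^ (-((d : ℝ) / 2)) ≤ σ ^ (-(d : ℝ)) := by
        apply Real.rpow_le_rpow_of_exponent_ge hσ h
        have : (0 : ℝ) ≤ d := by positivity
        linarith
      have e4 : σ ^ (-(d : ℝ)) = (σ ^ d)⁻¹ := by
        rw [Real.rpow_neg hσ.le, Real.rpow_natCast]
      rw [e1]
      calc σ ^ (-((d : ℝ) / 2)) * (Real.exp (1 / (4 * σ)))⁻¹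
          ≤ (σ ^ d)⁻¹ * (C * σ ^ (d + 1)) := by
            rw [← e4]; gcongr
        _ = C * σ := by rw [pow_succ]; field_simp
    nlinarith

/-- The two subtracted terms make the left side nonpositive for `σ ≤ 1/M` and for `σ ≥ 1/m`
respectively. Only the window `[1/M, 1/m]` remains, where the left side is at most `1` and the
profile is bounded below. -/
lemma exists_le_heatProfile (d : ℕ) {M m : ℝ} (hM : 0 < M) (hm : 0 < m) :
    ∃ C : ℝ, 0 < C ∧ ∀ σ : ℝ, 0 < σ →
      (1 - Real.exp (-σ)) - 2 / M * (1 - Real.exp (-(M * σ))) - 2 * (1 - Real.exp (-(m * σ))) ≤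
        C * heatProfile d σ 1 := by
  -- Each factor of the profile is taken at the end of the window where it is smallest.
  set c : ℝ := (1 / m) ^ (-((d : ℝ) / 2)) * Real.exp (-1 ^ 2 / (4 * (1 / M))) with hc
  have hcpos : 0 < c := by positivity
  refine ⟨1 / c, by positivity, fun σ hσ => ?_⟩
  have hpos : 0 ≤ 1 / c * heatProfile d σ 1 :=
    mul_nonneg (by positivity) (heatProfile_nonneg d hσ.le 1)
  have t1 : 0 ≤ 1 - Real.exp (-(M * σ)) := by
    rw [sub_nonneg, Real.exp_le_one_iff]; nlinarith [mul_pos hM hσ]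
  have t2 : 0 ≤ 1 - Real.exp (-(m * σ)) := by
    rw [sub_nonneg, Real.exp_le_one_iff]; nlinarith [mul_pos hm hσ]
  have t1' : 0 ≤ 2 / M * (1 - Real.exp (-(M * σ))) := by positivity
  rcases le_total (M * σ) 1 with h | h
  · have h1 := half_le_one_sub_exp_neg (mul_pos hM hσ).le h
    have h2 := one_sub_exp_neg_le σ
    have h3 : σ ≤ 2 / M * (1 - Real.exp (-(M * σ))) := by
      calc σ = 2 / M * (M * σ / 2) := by field_simp
        _ ≤ _ := by gcongr
    linarith
  rcases le_total 1 (m * σ) with h' | h'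
  · have h1 := half_le_one_sub_exp_neg (x := 1) (by norm_num) le_rfl
    have h2 : Real.exp (-(m * σ)) ≤ Real.exp (-1) := Real.exp_le_exp.2 (by linarith)
    have h3 := Real.exp_pos (-σ)
    linarith
  · have h1 : c ≤ heatProfile d σ 1 := by
      rw [hc]
      unfold heatProfile
      have hσm : σ ≤ 1 / m := by rw [le_div_iff₀ hm]; linarith
      have hσM : 1 / M ≤ σ := by rw [div_le_iff₀ hM]; linarith
      gcongr ?_ * Real.exp ?_
      · apply Real.rpow_le_rpow_of_nonpos hσ hσm
        have : (0 : ℝ) ≤ d := by positivity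
        linarith
      · rw [neg_div, neg_div, neg_le_neg_iff]
        gcongr
    have h2 : 1 ≤ 1 / c * heatProfile d σ 1 := by
      rw [one_div, ← div_eq_inv_mul, le_div_iff₀ hcpos]; linarith
    have h3 := Real.exp_pos (-σ)
    linarith

/-- The pointwise bounds that Gaussian mixtures with Laplace transform `F` inherit from the
Gaussian kernels. -/
structure MixtureBounds (d : ℕ) (C C' M m : ℝ) (F : ℝ → ℝ) : Prop where
  upper : ∀ x : EuclideanSpace ℝ (Fin d), x ≠ 0 →
    cosTransform (fun u : EuclideanSpace ℝ (Fin d) => F (‖u‖ ^ 2)) x ≤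
      C * (‖x‖ ^ (-(d : ℝ)) * (1 - F (‖x‖ ^ (-2 : ℝ))))
  lower : ∀ x : EuclideanSpace ℝ (Fin d), x ≠ 0 →
    ‖x‖ ^ (-(d : ℝ)) * ((1 - F (‖x‖ ^ (-2 : ℝ))) - 2 / M * (1 - F (M * ‖x‖ ^ (-2 : ℝ)))
      - 2 * (1 - F (m * ‖x‖ ^ (-2 : ℝ)))) ≤
      C' * cosTransform (fun u : EuclideanSpace ℝ (Fin d) => F (‖u‖ ^ 2)) x
  anti : ∀ x y : EuclideanSpace ℝ (Fin d), ‖x‖ ≤ ‖y‖ →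
    cosTransform (fun u : EuclideanSpace ℝ (Fin d) => F (‖u‖ ^ 2)) y ≤
      cosTransform (fun u : EuclideanSpace ℝ (Fin d) => F (‖u‖ ^ 2)) x

lemma tendsto_cosTransform {d : ℕ} {ρ : ℕ → EuclideanSpace ℝ (Fin d) → ℝ}
    {ρ' b : EuclideanSpace ℝ (Fin d) → ℝ}
    (hmeas : ∀ n, AEStronglyMeasurable (ρ n)) (hb : Integrable b)
    (hle : ∀ n u, |ρ n u| ≤ b u) (hlim : ∀ u, Tendsto (fun n => ρ n u) atTop (𝓝 (ρ' u)))
    (x : EuclideanSpace ℝ (Fin d)) :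
    Tendsto (fun n => cosTransform (ρ n) x) atTop (𝓝 (cosTransform ρ' x)) := by
  unfold cosTransform
  refine Tendsto.const_mul _ (tendsto_integral_of_dominated_convergence b ?_ hb ?_ ?_)
  · intro n
    exact AEStronglyMeasurable.mul (by fun_prop) (hmeas n)
  · intro n
    refine Eventually.of_forall fun u => ?_
    rw [norm_mul, Real.norm_eq_abs, Real.norm_eq_abs]
    calc _ ≤ 1 * |ρ n u| := by gcongr; exact Real.abs_cos_le_one _
      _ ≤ b u := by rw [one_mul]; exact hle n u
  · exact Eventually.of_forall fun u => (hlim u).const_mul _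

/-- For fixed points, each bound is a weak inequality between finitely many values of `F` and cosine
transforms; the latter converge by domination. No limiting mixing measure is needed. -/
lemma MixtureBounds.of_tendsto {d : ℕ} {C C' M m : ℝ} {F : ℕ → ℝ → ℝ} {G : ℝ → ℝ}
    {b : EuclideanSpace ℝ (Fin d) → ℝ} (hM : 0 ≤ M) (hm : 0 ≤ m)
    (hF : ∀ n, MixtureBounds d C C' M m (F n))
    (hmeas : ∀ n, Measurable (F n)) (hb : Integrable b)
    (hle : ∀ n u, |F n (‖u‖ ^ 2)| ≤ b u)
    (hlim : ∀ l, 0 ≤ l → Tendsto (fun n => F n l) atTop (𝓝 (G l))) :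
    MixtureBounds d C C' M m G := by
  have T := tendsto_cosTransform (ρ := fun n (u : EuclideanSpace ℝ (Fin d)) => F n (‖u‖ ^ 2))
    (ρ' := fun u => G (‖u‖ ^ 2))
    (fun n => ((hmeas n).comp (by fun_prop)).aestronglyMeasurable) hb hle
    (fun u => hlim _ (by positivity))
  refine ⟨fun x hx => ?_, fun x hx => ?_, fun x y hxy => ?_⟩
  · exact le_of_tendsto_of_tendsto' (T x)
      (((hlim _ (by positivity)).const_sub 1).const_mul _ |>.const_mul _)
      fun n => (hF n).upper x hx
  · refine le_of_tendsto_of_tendsto' (Tendsto.const_mul _ ?_) ((T x).const_mul _)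
      fun n => (hF n).lower x hx
    exact ((((hlim _ (by positivity)).const_sub 1).sub
      (((hlim _ (by positivity)).const_sub 1).const_mul _))).sub
      (((hlim _ (by positivity)).const_sub 1).const_mul _)
  · exact le_of_tendsto_of_tendsto' (T y) (T x) fun n => (hF n).anti x y hxy

section Mixture

variable {ν : Measure ℝ} [IsProbabilityMeasure ν] {κ : ℝ}

lemma integrable_exp_neg_mul (hκ : 0 < κ) (hν : ∀ᵐ s ∂ν, κ ≤ s) {l : ℝ} (hl : 0 ≤ l) :
    Integrable (fun s => Real.exp (-(l * s))) ν := by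
  refine Integrable.of_bound (by fun_prop) 1 ?_
  filter_upwards [hν] with s hs
  rw [Real.norm_eq_abs, abs_of_pos (Real.exp_pos _), Real.exp_le_one_iff]
  have := mul_nonneg hl (hκ.le.trans hs)
  linarith

lemma integrable_heatProfile (d : ℕ) (hκ : 0 < κ) (hν : ∀ᵐ s ∂ν, κ ≤ s) (r : ℝ) :
    Integrable (fun s => heatProfile d s r) ν := by
  refine Integrable.of_bound (C := κ ^ (-((d : ℝ) / 2))) ?_ ?_
  · unfold heatProfile
    exact Measurable.aestronglyMeasurable (by fun_prop)
  filter_upwards [hν] with s hs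
  have hs0 : 0 < s := hκ.trans_le hs
  rw [Real.norm_eq_abs, abs_of_nonneg (heatProfile_nonneg d hs0.le r)]
  unfold heatProfile
  refine (mul_le_of_le_one_right (by positivity) ?_).trans ?_
  · rw [Real.exp_le_one_iff, neg_div]
    have : 0 ≤ r ^ 2 / (4 * s) := by positivity
    linarith
  · apply Real.rpow_le_rpow_of_nonpos hκ hs
    have : (0 : ℝ) ≤ d := by positivity
    linarith

/-- Fubini applies because keeping the mixing law above `κ` gives the integrable majorant
`e^{-κ|u|²}`. -/
lemma cosTransform_mixture {d : ℕ} (hκ : 0 < κ) (hν : ∀ᵐ s ∂ν, κ ≤ s)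
    (x : EuclideanSpace ℝ (Fin d)) :
    cosTransform (fun u : EuclideanSpace ℝ (Fin d) => ∫ s, Real.exp (-(‖u‖ ^ 2 * s)) ∂ν) x =
      heatConst d * ∫ s, heatProfile d s ‖x‖ ∂ν := by
  have hint : Integrable (fun q : EuclideanSpace ℝ (Fin d) × ℝ =>
      Real.cos (inner ℝ x q.1) * Real.exp (-(‖q.1‖ ^ 2 * q.2))) (volume.prod ν) := by
    have hb := (integrable_exp_neg_mul_sq (d := d) hκ).mul_prod (integrable_const (1 : ℝ) (μ := ν))
    refine hb.mono' (by fun_prop) ?_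
    have hν' : ∀ᵐ q ∂((volume : Measure (EuclideanSpace ℝ (Fin d))).prod ν), κ ≤ q.2 :=
      Measure.quasiMeasurePreserving_snd.ae hν
    filter_upwards [hν'] with q hq
    rw [norm_mul, Real.norm_eq_abs, Real.norm_eq_abs, abs_of_pos (Real.exp_pos _), mul_one]
    calc _ ≤ 1 * Real.exp (-(‖q.1‖ ^ 2 * q.2)) := by gcongr; exact Real.abs_cos_le_one _
      _ ≤ Real.exp (-κ * ‖q.1‖ ^ 2) := by
        rw [one_mul, Real.exp_le_exp]
        have : ‖q.1‖ ^ 2 * κ ≤ ‖q.1‖ ^ 2 * q.2 := by gcongr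
        linarith
  have hswap := integral_integral_swap
    (f := fun (u : EuclideanSpace ℝ (Fin d)) s =>
      Real.cos (inner ℝ x u) * Real.exp (-(‖u‖ ^ 2 * s))) hint
  unfold cosTransform
  simp only [integral_const_mul] at hswap
  rw [hswap, ← integral_const_mul, ← integral_const_mul]
  refine integral_congr_ae ?_
  filter_upwards [hν] with s hs
  rw [← cosTransform_gaussian (hκ.trans_le hs)]
  unfold cosTransform
  simp only [mul_comm _ s, neg_mul]

/-- The one-variable inequalities are applied at `σ = s|x|^{-2}`, using Gaussian scaling, and
integrated in `s`. -/
lemma mixtureBounds_laplace {d : ℕ} {C C' M m : ℝ} (hM : 0 < M) (hm : 0 < m)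
    (hC : ∀ σ : ℝ, 0 < σ → heatProfile d σ 1 ≤ C * (1 - Real.exp (-σ)))
    (hC' : ∀ σ : ℝ, 0 < σ →
      (1 - Real.exp (-σ)) - 2 / M * (1 - Real.exp (-(M * σ))) - 2 * (1 - Real.exp (-(m * σ))) ≤
        C' * heatProfile d σ 1)
    (hκ : 0 < κ) (hν : ∀ᵐ s ∂ν, κ ≤ s) :
    MixtureBounds d (heatConst d * C) ((heatConst d)⁻¹ * C') M m
      (fun l => ∫ s, Real.exp (-(l * s)) ∂ν) := by
  have hA := heatConst_pos d
  have I1 : ∀ l : ℝ, 0 ≤ l → Integrable (fun s => 1 - Real.exp (-(l * s))) ν := fun l hl =>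
    (integrable_const 1).sub (integrable_exp_neg_mul hκ hν hl)
  have E1 : ∀ l : ℝ, 0 ≤ l → 1 - ∫ s, Real.exp (-(l * s)) ∂ν =
      ∫ s, (1 - Real.exp (-(l * s))) ∂ν := fun l hl => by
    rw [integral_sub (integrable_const 1) (integrable_exp_neg_mul hκ hν hl)]
    simp
  refine ⟨fun x hx => ?_, fun x hx => ?_, fun x y hxy => ?_⟩
  · have hr : 0 < ‖x‖ := norm_pos_iff.2 hx
    rw [cosTransform_mixture hκ hν, mul_assoc, E1 _ (by positivity)]
    refine mul_le_mul_of_nonneg_left ?_ hA.le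
    rw [← integral_const_mul, ← integral_const_mul]
    refine integral_mono_ae (integrable_heatProfile d hκ hν _)
      (((I1 _ (by positivity)).const_mul _).const_mul _) ?_
    filter_upwards [hν] with s hs
    have hs0 : 0 < s := hκ.trans_le hs
    rw [heatProfile_scale d hs0 hr]
    have := hC (s * ‖x‖ ^ (-2 : ℝ)) (by positivity)
    calc _ ≤ ‖x‖ ^ (-(d : ℝ)) * (C * (1 - Real.exp (-(s * ‖x‖ ^ (-2 : ℝ))))) := by gcongr
      _ = _ := by rw [mul_comm s]; ring
  · have hr : 0 < ‖x‖ := norm_pos_iff.2 hx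
    rw [cosTransform_mixture hκ hν, E1 _ (by positivity), E1 _ (by positivity),
      E1 _ (by positivity)]
    have : (heatConst d)⁻¹ * C' * (heatConst d * ∫ s, heatProfile d s ‖x‖ ∂ν) =
      C' * ∫ s, heatProfile d s ‖x‖ ∂ν := by field_simp
    rw [this, ← integral_const_mul, ← integral_const_mul, ← integral_const_mul, ← integral_sub,
      ← integral_sub, ← integral_const_mul]
    rotate_left
    · exact (I1 _ (by positivity)).sub ((I1 _ (by positivity)).const_mul _)
    · exact (I1 _ (by positivity)).const_mul _
    · exact I1 _ (by positivity)
    · exact (I1 _ (by positivity)).const_mul _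
    refine integral_mono_ae ((((I1 _ (by positivity)).sub
      ((I1 _ (by positivity)).const_mul _)).sub ((I1 _ (by positivity)).const_mul _)).const_mul _)
      ((integrable_heatProfile d hκ hν _).const_mul _) ?_
    filter_upwards [hν] with s hs
    have hs0 : 0 < s := hκ.trans_le hs
    rw [heatProfile_scale d hs0 hr]
    have h := hC' (s * ‖x‖ ^ (-2 : ℝ)) (by positivity)
    have e1 : ∀ k : ℝ, k * ‖x‖ ^ (-2 : ℝ) * s = k * (s * ‖x‖ ^ (-2 : ℝ)) := fun k => by ring
    rw [e1 M, e1 m, mul_comm (‖x‖ ^ (-2 : ℝ)) s]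
    calc _ ≤ ‖x‖ ^ (-(d : ℝ)) * (C' * heatProfile d (s * ‖x‖ ^ (-2 : ℝ)) 1) := by gcongr
      _ = _ := by ring
  · rw [cosTransform_mixture hκ hν, cosTransform_mixture hκ hν]
    refine mul_le_mul_of_nonneg_left ?_ hA.le
    refine integral_mono_ae (integrable_heatProfile d hκ hν _)
      (integrable_heatProfile d hκ hν _) ?_
    filter_upwards [hν] with s hs
    exact heatProfile_antitone d (hκ.trans_le hs) (norm_nonneg _) hxy

end Mixture

/-! ### Pareto sums approximating the stable Laplace transform. -/

section Pareto

open ProbabilityTheory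

/-- The Laplace transform of the Pareto law of index `β` on `[1, ∞)`. -/
noncomputable def paretoLaplace (β θ : ℝ) : ℝ := ∫ s, Real.exp (-(θ * s)) ∂(paretoMeasure 1 β)

/-- The integrand of the Lévy–Khintchine representation of `λ ^ β`, up to a constant. -/
noncomputable def levyIntegrand (β v : ℝ) : ℝ := (1 - Real.exp (-v)) * (β * v ^ (-(β + 1)))

lemma ae_one_le_pareto (β : ℝ) : ∀ᵐ s ∂(paretoMeasure 1 β), 1 ≤ s := by
  unfold paretoMeasure
  rw [ae_withDensity_iff (by unfold paretoPDF; fun_prop)]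
  refine Eventually.of_forall fun s hs => ?_
  by_contra h
  exact hs (paretoPDF_of_lt (not_le.1 h))

/-- Near zero the integrand is at most `β v^{-β}`, integrable since `β < 1`; at infinity it is at
most `β v^{-β-1}`, integrable since `β > 0`. -/
lemma integrableOn_levyIntegrand {β : ℝ} (h0 : 0 < β) (h1 : β < 1) :
    IntegrableOn (levyIntegrand β) (Set.Ioi 0) := by
  have hmeas : Measurable (levyIntegrand β) := by unfold levyIntegrand; fun_prop
  rw [← Set.Ioc_union_Ioi_eq_Ioi (zero_le_one' ℝ)]
  refine IntegrableOn.union ?_ ?_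
  · have hI : IntegrableOn (fun v : ℝ => β * v ^ (-β)) (Set.Ioc 0 1) := by
      rw [← intervalIntegrable_iff_integrableOn_Ioc_of_le zero_le_one]
      exact (intervalIntegral.intervalIntegrable_rpow' (by linarith)).const_mul _
    refine Integrable.mono' hI hmeas.aestronglyMeasurable ?_
    refine (ae_restrict_iff' measurableSet_Ioc).2 (Eventually.of_forall fun v hv => ?_)
    have hv0 : 0 < v := hv.1
    have e := one_sub_exp_neg_le v
    have e' : 0 ≤ 1 - Real.exp (-v) := by
      rw [sub_nonneg, Real.exp_le_one_iff]; linarith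
    unfold levyIntegrand
    rw [Real.norm_eq_abs, abs_of_nonneg (by positivity)]
    calc _ ≤ v * (β * v ^ (-(β + 1))) := by gcongr
      _ = β * (v ^ (1 : ℝ) * v ^ (-(β + 1))) := by rw [Real.rpow_one]; ring
      _ = _ := by rw [← Real.rpow_add hv0]; ring_nf
  · have hI : IntegrableOn (fun v : ℝ => β * v ^ (-(β + 1))) (Set.Ioi 1) :=
      (integrableOn_Ioi_rpow_of_lt (by linarith) one_pos).const_mul _
    refine Integrable.mono' hI hmeas.aestronglyMeasurable ?_
    refine (ae_restrict_iff' measurableSet_Ioi).2 (Eventually.of_forall fun v hv => ?_)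
    have hv0 : 0 < v := one_pos.trans hv
    have e := Real.exp_pos (-v)
    have e' : 0 ≤ 1 - Real.exp (-v) := by
      rw [sub_nonneg, Real.exp_le_one_iff]; linarith
    unfold levyIntegrand
    rw [Real.norm_eq_abs, abs_of_nonneg (by positivity)]
    refine mul_le_of_le_one_left (by positivity) (by linarith)

lemma integral_levyIntegrand_pos {β : ℝ} (h0 : 0 < β) (h1 : β < 1) :
    0 < ∫ v in Set.Ioi 0, levyIntegrand β v := by
  rw [setIntegral_pos_iff_support_of_nonneg_ae _ (integrableOn_levyIntegrand h0 h1)]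
  · have : Set.Ioi (0 : ℝ) ⊆ Function.support (levyIntegrand β) ∩ Set.Ioi 0 := by
      intro v hv
      refine ⟨?_, hv⟩
      have hv0 : 0 < v := hv
      have e' : 0 < 1 - Real.exp (-v) := by
        rw [sub_pos, Real.exp_lt_one_iff]; linarith
      rw [Function.mem_support]
      unfold levyIntegrand
      positivity
    exact lt_of_lt_of_le (by simp) (measure_mono this)
  · refine (ae_restrict_iff' measurableSet_Ioi).2 (Eventually.of_forall fun v hv => ?_)
    have hv0 : 0 < v := hv
    have e' : 0 ≤ 1 - Real.exp (-v) := by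
      rw [sub_nonneg, Real.exp_le_one_iff]; linarith
    unfold levyIntegrand
    simp only [Pi.zero_apply]
    positivity

/-- Substituting `v = θs` in the power density produces the factor `θ^β` and moves the cutoff from
`1` to `θ`. -/
lemma one_sub_paretoLaplace {β θ : ℝ} (h0 : 0 < β) (hθ : 0 < θ) :
    1 - paretoLaplace β θ = θ ^ β * ∫ v in Set.Ioi θ, levyIntegrand β v := by
  have := isProbabilityMeasure_paretoMeasure one_pos h0
  have hν := ae_one_le_pareto β
  have e1 : 1 - paretoLaplace β θ = ∫ s, (1 - Real.exp (-(θ * s))) ∂(paretoMeasure 1 β) := by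
    rw [integral_sub (integrable_const 1) (integrable_exp_neg_mul one_pos hν hθ.le)]
    simp [paretoLaplace]
  rw [e1]
  unfold paretoMeasure
  rw [integral_withDensity_eq_integral_toReal_smul (by unfold paretoPDF; fun_prop)
    (Eventually.of_forall fun s => by simp [paretoPDF])]
  have e2 : ∀ s : ℝ, (paretoPDF 1 β s).toReal • (1 - Real.exp (-(θ * s))) =
      (Set.Ici 1).indicator (fun s => (θ ^ (β + 1)) * levyIntegrand β (θ * s)) s := by
    intro s
    by_cases hs : 1 ≤ s
    · have hs0 : 0 < s := one_pos.trans_le hs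
      rw [Set.indicator_of_mem (by exact hs), paretoPDF_of_le hs,
        ENNReal.toReal_ofReal (by positivity), smul_eq_mul]
      unfold levyIntegrand
      rw [Real.mul_rpow hθ.le hs0.le, Real.one_rpow, Real.rpow_neg hθ.le]
      have : θ ^ (β + 1) ≠ 0 := by positivity
      field_simp
    · rw [Set.indicator_of_notMem (by exact hs), paretoPDF_of_lt (not_le.1 hs)]
      simp
  simp only [e2]
  rw [integral_indicator measurableSet_Ici, integral_Ici_eq_integral_Ioi, integral_const_mul,
    integral_comp_mul_left_Ioi _ _ hθ, mul_one, smul_eq_mul, ← mul_assoc, Real.rpow_add hθ,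
    Real.rpow_one]
  field_simp

/-- With `K` the full integral, `1 - paretoLaplace β θ ~ K θ^β` as `θ ↓ 0`. For `l > 0`, the scale
`(Kn)^{-1/β}` makes this `l^β/n` to first order, and `(1 + a_n/n)^n → e^a` when `a_n → a`. -/
lemma tendsto_paretoLaplace_pow {β : ℝ} (h0 : 0 < β) (h1 : β < 1) {l : ℝ} (hl : 0 ≤ l) :
    Tendsto (fun n : ℕ => paretoLaplace β
      (l * ((∫ v in Set.Ioi 0, levyIntegrand β v) * n) ^ (-β⁻¹)) ^ n) atTop
      (𝓝 (Real.exp (-(l ^ β)))) := by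
  have := isProbabilityMeasure_paretoMeasure one_pos h0
  set K := ∫ v in Set.Ioi 0, levyIntegrand β v with hK
  have hKpos : 0 < K := integral_levyIntegrand_pos h0 h1
  rcases hl.eq_or_lt with rfl | hl
  · simp [paretoLaplace, Real.zero_rpow h0.ne']
  set θ : ℕ → ℝ := fun n => l * (K * n) ^ (-β⁻¹) with hθ
  have hθlim : Tendsto θ atTop (𝓝 0) := by
    have h2 : Tendsto (fun n : ℕ => K * (n : ℝ)) atTop atTop :=
      tendsto_natCast_atTop_atTop.const_mul_atTop hKpos
    have h3 := ((tendsto_rpow_neg_atTop (inv_pos.2 h0)).comp h2).const_mul l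
    simpa [hθ, Function.comp_def] using h3
  have hJ : Tendsto (fun n => ∫ v in Set.Ioi (θ n), levyIntegrand β v) atTop (𝓝 K) := by
    have hc := (aecover_Ioi_of_Ioi (μ := volume) hθlim).integral_tendsto_of_countably_generated
      (integrableOn_levyIntegrand h0 h1)
    refine hc.congr fun n => ?_
    rw [Measure.restrict_restrict measurableSet_Ioi]
    congr 2
    refine Set.inter_eq_left.2 (Set.Ioi_subset_Ioi ?_)
    simp only [hθ]
    positivity
  have hg : Tendsto (fun n : ℕ => (n : ℝ) * (paretoLaplace β (θ n) - 1)) atTop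
      (𝓝 (-(l ^ β))) := by
    have h2 : Tendsto (fun n : ℕ => -(l ^ β / K * ∫ v in Set.Ioi (θ n), levyIntegrand β v)) atTop
        (𝓝 (-(l ^ β))) := by
      have := (hJ.const_mul (l ^ β / K)).neg
      rwa [div_mul_cancel₀ _ hKpos.ne'] at this
    refine h2.congr' ?_
    filter_upwards [eventually_gt_atTop 0] with n hn
    have hn' : (0 : ℝ) < n := by exact_mod_cast hn
    have hpos : 0 < θ n := by simp only [hθ]; positivity
    have e := one_sub_paretoLaplace h0 hpos
    have e2 : θ n ^ β = l ^ β / (K * n) := by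
      simp only [hθ]
      rw [Real.mul_rpow hl.le (by positivity), ← Real.rpow_mul (by positivity), neg_mul,
        inv_mul_cancel₀ h0.ne', Real.rpow_neg_one]
      rfl
    rw [← neg_sub, e, e2]
    field_simp
  refine (Real.tendsto_one_add_pow_exp_of_tendsto hg).congr fun n => ?_
  simp [hθ]

/-- The law of `κ + b (X₁ + ⋯ + Xₙ)` for independent Pareto variables `Xᵢ`. -/
noncomputable def paretoSum (β κ b : ℝ) (n : ℕ) : Measure ℝ :=
  (Measure.pi fun _ : Fin n => paretoMeasure 1 β).map (fun ω => κ + b * ∑ i, ω i)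

lemma isProbabilityMeasure_paretoSum {β : ℝ} (h0 : 0 < β) (κ b : ℝ) (n : ℕ) :
    IsProbabilityMeasure (paretoSum β κ b n) := by
  have := isProbabilityMeasure_paretoMeasure one_pos h0
  exact Measure.isProbabilityMeasure_map (by fun_prop)

lemma ae_le_paretoSum {β : ℝ} (h0 : 0 < β) (κ : ℝ) {b : ℝ} (hb : 0 ≤ b) (n : ℕ) :
    ∀ᵐ s ∂(paretoSum β κ b n), κ ≤ s := by
  have := isProbabilityMeasure_paretoMeasure one_pos h0
  unfold paretoSum
  rw [ae_map_iff (by fun_prop) measurableSet_Ici]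
  have h : ∀ᵐ ω ∂(Measure.pi fun _ : Fin n => paretoMeasure 1 β), ∀ i, 1 ≤ ω i := by
    rw [ae_all_iff]
    intro i
    exact (measurePreserving_eval (fun _ : Fin n => paretoMeasure 1 β) i).quasiMeasurePreserving.ae
      (ae_one_le_pareto β)
  filter_upwards [h] with ω hω
  have : 0 ≤ ∑ i, ω i := Finset.sum_nonneg fun i _ => zero_le_one.trans (hω i)
  have := mul_nonneg hb this
  linarith

lemma laplace_paretoSum {β : ℝ} (h0 : 0 < β) (κ b : ℝ) (n : ℕ) (l : ℝ) :
    ∫ s, Real.exp (-(l * s)) ∂(paretoSum β κ b n) =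
      Real.exp (-(l * κ)) * paretoLaplace β (l * b) ^ n := by
  have := isProbabilityMeasure_paretoMeasure one_pos h0
  unfold paretoSum
  rw [integral_map (by fun_prop) (by fun_prop)]
  have e : ∀ ω : Fin n → ℝ, Real.exp (-(l * (κ + b * ∑ i, ω i))) =
      Real.exp (-(l * κ)) * ∏ i, Real.exp (-(l * b * ω i)) := by
    intro ω
    rw [← Real.exp_sum, ← Real.exp_add]
    congr 1
    rw [Finset.sum_neg_distrib, ← Finset.mul_sum]
    ring
  simp only [e]
  rw [integral_const_mul, integral_fintype_prod_eq_pow (fun s => Real.exp (-(l * b * s)))]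
  simp [paretoLaplace]

end Pareto

/-! ### Stable density at time one. -/

lemma integrable_exp_neg_mul_norm_rpow {d : ℕ} (hd : 0 < d) {α t : ℝ} (hα : 0 < α) (ht : 0 < t) :
    Integrable (fun u : EuclideanSpace ℝ (Fin d) => Real.exp (-t * ‖u‖ ^ α)) := by
  have : Nonempty (Fin d) := ⟨⟨0, hd⟩⟩
  rw [integrable_fun_norm_addHaar volume (f := fun r => Real.exp (-t * r ^ α))]
  have h := integrableOn_rpow_mul_exp_neg_mul_rpow (p := α) (s := ((d - 1 : ℕ) : ℝ)) (b := t)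
    (lt_of_lt_of_le (by norm_num) (Nat.cast_nonneg _)) hα ht
  refine h.congr_fun (fun r hr => ?_) measurableSet_Ioi
  simp [Real.rpow_natCast]

lemma stableDensity_eq_cosTransform {d : ℕ} (hd : 0 < d) {α t : ℝ} (hα : 0 < α) (ht : 0 < t)
    (x : EuclideanSpace ℝ (Fin d)) :
    stableDensity d α t x = cosTransform (fun u => Real.exp (-t * ‖u‖ ^ α)) x := by
  unfold stableDensity cosTransform
  rw [re_integral_cexp_mul (integrable_exp_neg_mul_norm_rpow hd hα ht)]

lemma mixtureBounds_stable {d : ℕ} (hd : 0 < d) {β C C' M m : ℝ} (hβ : 0 < β) (hβ1 : β < 1)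
    (hM : 0 < M) (hm : 0 < m)
    (hC : ∀ σ : ℝ, 0 < σ → heatProfile d σ 1 ≤ C * (1 - Real.exp (-σ)))
    (hC' : ∀ σ : ℝ, 0 < σ →
      (1 - Real.exp (-σ)) - 2 / M * (1 - Real.exp (-(M * σ))) - 2 * (1 - Real.exp (-(m * σ))) ≤
        C' * heatProfile d σ 1) :
    MixtureBounds d (heatConst d * C) ((heatConst d)⁻¹ * C') M m
      (fun l => Real.exp (-(l ^ β))) := by
  -- The drift `κ` supplies a majorant `e^{-κ|u|²}` uniform in the number of summands.
  have key : ∀ κ : ℝ, 0 < κ → MixtureBounds d (heatConst d * C) ((heatConst d)⁻¹ * C') M m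
      (fun l => Real.exp (-(l * κ)) * Real.exp (-(l ^ β))) := by
    intro κ hκ
    set b : ℕ → ℝ := fun n => ((∫ v in Set.Ioi 0, levyIntegrand β v) * n) ^ (-β⁻¹) with hb
    have hKpos := integral_levyIntegrand_pos hβ hβ1
    have hbn : ∀ n, 0 ≤ b n := fun n => by simp only [hb]; positivity
    have hP : ∀ n, IsProbabilityMeasure (paretoSum β κ (b n) n) := fun n =>
      isProbabilityMeasure_paretoSum hβ κ (b n) n
    refine MixtureBounds.of_tendsto (F := fun n l => ∫ s, Real.exp (-(l * s)) ∂(paretoSum β κ (b n) n))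
      (b := fun u => Real.exp (-κ * ‖u‖ ^ 2)) hM.le hm.le (fun n => ?_) (fun n => ?_)
      (integrable_exp_neg_mul_sq hκ) (fun n u => ?_) (fun l hl => ?_)
    · exact mixtureBounds_laplace hM hm hC hC' hκ (ae_le_paretoSum hβ κ (hbn n) n)
    · refine StronglyMeasurable.measurable
        (StronglyMeasurable.integral_prod_right' (ν := paretoSum β κ (b n) n)
        (f := fun q : ℝ × ℝ => Real.exp (-(q.1 * q.2))) ?_)
      exact Measurable.stronglyMeasurable (by fun_prop)
    · rw [abs_of_nonneg (integral_nonneg fun s => (Real.exp_pos _).le)]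
      have hν := ae_le_paretoSum hβ κ (hbn n) n
      calc _ ≤ ∫ s, Real.exp (-κ * ‖u‖ ^ 2) ∂(paretoSum β κ (b n) n) := by
            refine integral_mono_ae (integrable_exp_neg_mul hκ hν (by positivity))
              (integrable_const _) ?_
            filter_upwards [hν] with s hs
            rw [Real.exp_le_exp]
            have : ‖u‖ ^ 2 * κ ≤ ‖u‖ ^ 2 * s := by gcongr
            linarith
        _ = _ := by simp
    · simp only [laplace_paretoSum hβ]
      exact (tendsto_paretoLaplace_pow hβ hβ1 hl).const_mul _
  -- The drift is now removed along `κ = 1/(n+1)`, with the stable symbol itself as majorant.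
  refine MixtureBounds.of_tendsto
    (F := fun (n : ℕ) l => Real.exp (-(l * (1 / ((n : ℝ) + 1)))) * Real.exp (-(l ^ β)))
    (b := fun u => Real.exp (-1 * ‖u‖ ^ (2 * β))) hM.le hm.le (fun n => key _ (by positivity))
    (fun n => by fun_prop) (integrable_exp_neg_mul_norm_rpow hd (by positivity) one_pos)
    (fun n u => ?_) (fun l hl => ?_)
  · rw [abs_of_nonneg (by positivity)]
    have e : (‖u‖ ^ 2) ^ β = ‖u‖ ^ (2 * β) := by
      rw [Real.rpow_mul (norm_nonneg _)]; norm_cast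
    rw [e, neg_one_mul]
    refine mul_le_of_le_one_left (Real.exp_pos _).le ?_
    rw [Real.exp_le_one_iff]
    have : 0 ≤ ‖u‖ ^ 2 * (1 / ((n : ℝ) + 1)) := by positivity
    linarith
  · have h1 : Tendsto (fun n : ℕ => Real.exp (-(l * (1 / ((n : ℝ) + 1))))) atTop (𝓝 1) := by
      have := (tendsto_one_div_add_atTop_nhds_zero_nat (𝕜 := ℝ)).const_mul l
      have h2 := (Real.continuous_exp.tendsto _).comp this.neg
      simpa [Function.comp_def] using h2
    simpa using h1.mul_const (Real.exp (-(l ^ β)))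

lemma exists_stableDensity_one_bounds {d : ℕ} (hd : 0 < d) {α : ℝ} (h0 : 0 < α) (h2 : α < 2) :
    ∃ C c : ℝ, 0 < C ∧ 0 < c ∧
      (∀ x : EuclideanSpace ℝ (Fin d), stableDensity d α 1 x ≤ C) ∧
      (∀ x : EuclideanSpace ℝ (Fin d), x ≠ 0 →
        stableDensity d α 1 x ≤ C * ‖x‖ ^ (-((d : ℝ) + α))) ∧
      (∀ x : EuclideanSpace ℝ (Fin d), ‖x‖ ≤ 1 → c ≤ stableDensity d α 1 x) ∧
      (∀ x : EuclideanSpace ℝ (Fin d), 1 ≤ ‖x‖ →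
        c * ‖x‖ ^ (-((d : ℝ) + α)) ≤ stableDensity d α 1 x) := by
  obtain ⟨β, rfl⟩ : ∃ β, α = 2 * β := ⟨α / 2, by ring⟩
  have hβ : 0 < β := by linarith
  have hβ1 : β < 1 := by linarith
  -- These choices give `M^β = M/16` and `m^β = 1/16`. With `ρ = |x|^{-α} ≤ 1`, each subtracted term
  -- in the lower mixture bound is then at most `ρ/8`, against a main term of at least `ρ/2`.
  set M : ℝ := 16 ^ (1 - β)⁻¹ with hMdef
  set m : ℝ := 16 ^ (-β⁻¹) with hmdef
  have hM : 0 < M := by positivity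
  have hm : 0 < m := by positivity
  have hMβ : M ^ β = M / 16 := by
    have : M ^ (1 - β) = 16 := by
      rw [hMdef, ← Real.rpow_mul (by norm_num), inv_mul_cancel₀ (by linarith), Real.rpow_one]
    rw [Real.rpow_sub hM, Real.rpow_one] at this
    have h3 : M ^ β ≠ 0 := by positivity
    field_simp at this
    linarith
  have hmβ : m ^ β = 1 / 16 := by
    rw [hmdef, ← Real.rpow_mul (by norm_num), neg_mul, inv_mul_cancel₀ hβ.ne', Real.rpow_neg_one]
    norm_num
  obtain ⟨C, hCpos, hC⟩ := exists_heatProfile_le d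
  obtain ⟨C', hCpos', hC'⟩ := exists_le_heatProfile d hM hm
  have hA := heatConst_pos d
  have B := mixtureBounds_stable hd hβ hβ1 hM hm hC hC'
  have hp : ∀ x : EuclideanSpace ℝ (Fin d), stableDensity d (2 * β) 1 x =
      cosTransform (fun u : EuclideanSpace ℝ (Fin d) => Real.exp (-((‖u‖ ^ 2) ^ β))) x := by
    intro x
    rw [stableDensity_eq_cosTransform hd h0 one_pos]
    congr 1
    funext u
    rw [Real.rpow_mul (norm_nonneg _), neg_one_mul]
    norm_cast
  have hF : ∀ r : ℝ, 0 < r → (r ^ (-2 : ℝ)) ^ β = r ^ (-(2 * β)) := by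
    intro r hr
    rw [← Real.rpow_mul hr.le]; ring_nf
  have hadd : ∀ r : ℝ, 0 < r → r ^ (-((d : ℝ) + 2 * β)) = r ^ (-(d : ℝ)) * r ^ (-(2 * β)) := by
    intro r hr
    rw [← Real.rpow_add hr]; ring_nf
  obtain ⟨c, hc, hcb⟩ : ∃ c : ℝ, 0 < c ∧ ∀ x : EuclideanSpace ℝ (Fin d), 1 ≤ ‖x‖ →
        c * ‖x‖ ^ (-((d : ℝ) + 2 * β)) ≤ stableDensity d (2 * β) 1 x := by
    refine ⟨1 / (4 * ((heatConst d)⁻¹ * C')), by positivity, fun x hx => ?_⟩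
    have hr : 0 < ‖x‖ := one_pos.trans_le hx
    have h := B.lower x (norm_pos_iff.1 hr)
    rw [← hp, Real.mul_rpow hM.le (by positivity), Real.mul_rpow hm.le (by positivity), hF _ hr,
      hMβ, hmβ] at h
    set ρ := ‖x‖ ^ (-(2 * β)) with hρ
    have hρ0 : 0 < ρ := by positivity
    have hρ1 : ρ ≤ 1 := Real.rpow_le_one_of_one_le_of_nonpos hx (by linarith)
    have e1 := half_le_one_sub_exp_neg hρ0.le hρ1
    have e2 := one_sub_exp_neg_le (M / 16 * ρ)
    have e3 := one_sub_exp_neg_le (1 / 16 * ρ)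
    have e4 : 2 / M * (1 - Real.exp (-(M / 16 * ρ))) ≤ ρ / 8 := by
      calc _ ≤ 2 / M * (M / 16 * ρ) := by gcongr
        _ = ρ / 8 := by field_simp; norm_num
    have e5 : ‖x‖ ^ (-(d : ℝ)) * (ρ / 4) ≤
        (heatConst d)⁻¹ * C' * stableDensity d (2 * β) 1 x := by
      refine le_trans ?_ h
      gcongr
      linarith
    rw [hadd _ hr, one_div, inv_mul_le_iff₀ (by positivity)]
    linarith
  have hupper : ∀ x : EuclideanSpace ℝ (Fin d), x ≠ 0 →
      stableDensity d (2 * β) 1 x ≤ heatConst d * C * ‖x‖ ^ (-((d : ℝ) + 2 * β)) := by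
    intro x hx
    have hr : 0 < ‖x‖ := norm_pos_iff.2 hx
    have h := B.upper x hx
    rw [← hp, hF _ hr] at h
    rw [hadd _ hr]
    refine h.trans ?_
    have := one_sub_exp_neg_le (‖x‖ ^ (-(2 * β)))
    gcongr
  set C₀ := max (stableDensity d (2 * β) 1 0) (heatConst d * C)
  have hC₀ : heatConst d * C ≤ C₀ := le_max_right _ _
  refine ⟨C₀, c, lt_of_lt_of_le (by positivity) hC₀, hc, fun x => ?_, fun x hx => ?_,
    fun x hx => ?_, hcb⟩
  · refine le_trans ?_ (le_max_left _ _)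
    rw [hp, hp]
    exact B.anti 0 x (by simp)
  · exact (hupper x hx).trans (by gcongr)
  -- Radial monotonicity transfers the tail bound at a unit vector to the whole unit ball.
  · set e : EuclideanSpace ℝ (Fin d) := EuclideanSpace.single ⟨0, hd⟩ 1
    have he : ‖e‖ = 1 := by simp [e]
    have h1 := hcb e he.ge
    rw [he, Real.one_rpow, mul_one] at h1
    refine h1.trans ?_
    rw [hp, hp]
    exact B.anti x e (by rw [he]; exact hx)

/-! ### Scaling to all times, and consequences of the two-sided bounds. -/

lemma cosTransform_comp_smul {d : ℕ} (ρ : EuclideanSpace ℝ (Fin d) → ℝ) {k : ℝ} (hk : 0 < k)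
    (x : EuclideanSpace ℝ (Fin d)) :
    cosTransform (fun u => ρ (k • u)) x = (k ^ d)⁻¹ * cosTransform ρ (k⁻¹ • x) := by
  have h := Measure.integral_comp_smul (volume : Measure (EuclideanSpace ℝ (Fin d)))
    (fun u => Real.cos (inner ℝ (k⁻¹ • x) u) * ρ u) k
  have e : ∀ u : EuclideanSpace ℝ (Fin d), inner ℝ (k⁻¹ • x) (k • u) = inner ℝ x u := by
    intro u
    rw [real_inner_smul_left, real_inner_smul_right]
    field_simp
  simp only [e, finrank_euclideanSpace, Fintype.card_fin, smul_eq_mul] at h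
  unfold cosTransform
  rw [h, abs_of_pos (by positivity)]
  ring

lemma stableDensity_scale {d : ℕ} (hd : 0 < d) {α t : ℝ} (hα : 0 < α) (ht : 0 < t)
    (x : EuclideanSpace ℝ (Fin d)) :
    stableDensity d α t x = ((t ^ α⁻¹) ^ d)⁻¹ * stableDensity d α 1 ((t ^ α⁻¹)⁻¹ • x) := by
  have hk : 0 < t ^ α⁻¹ := by positivity
  rw [stableDensity_eq_cosTransform hd hα ht, stableDensity_eq_cosTransform hd hα one_pos,
    ← cosTransform_comp_smul _ hk]
  congr 1
  funext u
  rw [norm_smul, Real.norm_of_nonneg hk.le, Real.mul_rpow hk.le (norm_nonneg _),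
    Real.rpow_inv_rpow ht.le hα.ne']
  ring_nf

/-- Two-sided comparison of `p_t(x)` with `t^{-d/α} ∧ t|x|^{-d-α}`. -/
structure StableBounds (d : ℕ) (α C c : ℝ) : Prop where
  le_diag : ∀ {t : ℝ}, 0 < t → ∀ x, stableDensity d α t x ≤ C * t ^ (-((d : ℝ) / α))
  le_tail : ∀ {t : ℝ}, 0 < t → ∀ x, x ≠ 0 →
    stableDensity d α t x ≤ C * (t * ‖x‖ ^ (-((d : ℝ) + α)))
  diag_le : ∀ {t : ℝ}, 0 < t → ∀ x : EuclideanSpace ℝ (Fin d), ‖x‖ ^ α ≤ t →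
    c * t ^ (-((d : ℝ) / α)) ≤ stableDensity d α t x
  tail_le : ∀ {t : ℝ}, 0 < t → ∀ x : EuclideanSpace ℝ (Fin d), t ≤ ‖x‖ ^ α →
    c * (t * ‖x‖ ^ (-((d : ℝ) + α))) ≤ stableDensity d α t x

lemma exists_stableBounds {d : ℕ} (hd : 0 < d) {α : ℝ} (h0 : 0 < α) (h2 : α < 2) :
    ∃ C c : ℝ, 0 < C ∧ 0 < c ∧ StableBounds d α C c := by
  obtain ⟨C, c, hC, hc, b1, b2, b3, b4⟩ := exists_stableDensity_one_bounds hd h0 h2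
  refine ⟨C, c, hC, hc, ?_⟩
  have ek : ∀ t : ℝ, 0 < t → ((t ^ α⁻¹) ^ d)⁻¹ = t ^ (-((d : ℝ) / α)) := by
    intro t ht
    rw [← Real.rpow_natCast, ← Real.rpow_mul ht.le, ← Real.rpow_neg ht.le]
    congr 1
    field_simp
  have en : ∀ t : ℝ, 0 < t → ∀ x : EuclideanSpace ℝ (Fin d),
      ‖(t ^ α⁻¹)⁻¹ • x‖ = (t ^ α⁻¹)⁻¹ * ‖x‖ := by
    intro t ht x
    rw [norm_smul, Real.norm_of_nonneg (by positivity)]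
  have et : ∀ t : ℝ, 0 < t → ∀ r : ℝ, 0 ≤ r → t ^ (-((d : ℝ) / α)) *
      ((t ^ α⁻¹)⁻¹ * r) ^ (-((d : ℝ) + α)) = t * r ^ (-((d : ℝ) + α)) := by
    intro t ht r hr
    rw [Real.mul_rpow (by positivity) hr, ← Real.rpow_neg ht.le, ← Real.rpow_mul ht.le, ← mul_assoc,
      ← Real.rpow_add ht]
    have : -((d : ℝ) / α) + -α⁻¹ * -((d : ℝ) + α) = 1 := by field_simp; ring
    rw [this, Real.rpow_one]
  have ec : ∀ t : ℝ, 0 < t → ∀ r : ℝ, 0 ≤ r → ((t ^ α⁻¹)⁻¹ * r ≤ 1 ↔ r ^ α ≤ t) := by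
    intro t ht r hr
    rw [inv_mul_le_iff₀ (by positivity), mul_one, Real.le_rpow_inv_iff_of_pos hr ht.le h0]
  have ec' : ∀ t : ℝ, 0 < t → ∀ r : ℝ, 0 ≤ r → (1 ≤ (t ^ α⁻¹)⁻¹ * r ↔ t ≤ r ^ α) := by
    intro t ht r hr
    rw [le_inv_mul_iff₀ (by positivity), mul_one, Real.rpow_inv_le_iff_of_pos ht.le hr h0]
  refine ⟨fun {t} ht x => ?_, fun {t} ht x hx => ?_, fun {t} ht x hx => ?_, fun {t} ht x hx => ?_⟩
  all_goals rw [stableDensity_scale hd h0 ht, ek t ht]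
  · rw [mul_comm C]
    gcongr
    exact b1 _
  · have hk : (t ^ α⁻¹)⁻¹ ≠ 0 := by positivity
    have := b2 ((t ^ α⁻¹)⁻¹ • x) (smul_ne_zero hk hx)
    rw [en t ht] at this
    rw [← et t ht _ (norm_nonneg x)]
    calc _ ≤ t ^ (-((d : ℝ) / α)) * (C * ((t ^ α⁻¹)⁻¹ * ‖x‖) ^ (-((d : ℝ) + α))) := by gcongr
      _ = _ := by ring
  · rw [mul_comm c]
    gcongr
    refine b3 _ ?_
    rwa [en t ht, ec t ht _ (norm_nonneg x)]
  · have := b4 ((t ^ α⁻¹)⁻¹ • x) (by rwa [en t ht, ec' t ht _ (norm_nonneg x)])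
    rw [en t ht] at this
    rw [← et t ht _ (norm_nonneg x)]
    calc _ = t ^ (-((d : ℝ) / α)) * (c * ((t ^ α⁻¹)⁻¹ * ‖x‖) ^ (-((d : ℝ) + α))) := by ring
      _ ≤ _ := by gcongr

lemma StableBounds.nonneg {d : ℕ} {α C c : ℝ} (hc : 0 < c) (B : StableBounds d α C c) {t : ℝ}
    (ht : 0 < t) (x : EuclideanSpace ℝ (Fin d)) : 0 ≤ stableDensity d α t x := by
  rcases le_total (‖x‖ ^ α) t with h | h
  · exact le_trans (by positivity) (B.diag_le ht x h)
  · exact le_trans (by positivity) (B.tail_le ht x h)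

lemma measurable_stableDensity {d : ℕ} (hd : 0 < d) {α t : ℝ} (hα : 0 < α) (ht : 0 < t) :
    Measurable (stableDensity d α t) := by
  have : stableDensity d α t = cosTransform (fun u => Real.exp (-t * ‖u‖ ^ α)) :=
    funext fun x => stableDensity_eq_cosTransform hd hα ht x
  rw [this]
  unfold cosTransform
  refine Measurable.const_mul (StronglyMeasurable.measurable
    (StronglyMeasurable.integral_prod_right'
      (f := fun q : EuclideanSpace ℝ (Fin d) × EuclideanSpace ℝ (Fin d) =>
        Real.cos (inner ℝ q.1 q.2) * Real.exp (-t * ‖q.2‖ ^ α)) ?_)) _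
  exact Measurable.stronglyMeasurable (by fun_prop)

/-- At time one the density is dominated by a multiple of `(1+|x|)^{-d-α}`, and scaling preserves
the integral. A bound uniform in `t` suffices later, so the exact mass is not computed. -/
lemma exists_lintegral_stableDensity_le {d : ℕ} (hd : 0 < d) {α C c : ℝ} (h0 : 0 < α)
    (hC : 0 < C) (B : StableBounds d α C c) :
    ∃ K : ℝ, 0 < K ∧ ∀ t : ℝ, 0 < t →
      ∫⁻ x, ENNReal.ofReal (stableDensity d α t x) ≤ ENNReal.ofReal K := by
  set g : EuclideanSpace ℝ (Fin d) → ℝ := fun x =>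
    C * 2 ^ ((d : ℝ) + α) * (1 + ‖x‖) ^ (-((d : ℝ) + α)) with hg
  have hgi : Integrable g := (integrable_one_add_norm (by simp [h0])).const_mul _
  have hg0 : ∀ x, 0 ≤ g x := fun x => by simp only [hg]; positivity
  have hle : ∀ x, stableDensity d α 1 x ≤ g x := by
    intro x
    have e : ∀ r : ℝ, 0 < r → r ^ (-((d : ℝ) + α)) = 2 ^ ((d : ℝ) + α) * (2 * r) ^ (-((d : ℝ) + α)) := by
      intro r hr
      rw [Real.mul_rpow (by norm_num) hr.le, ← mul_assoc, ← Real.rpow_add (by norm_num)]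
      simp
    have hneg : -((d : ℝ) + α) ≤ 0 := by
      have : (0 : ℝ) ≤ d := by positivity
      linarith
    rcases le_total ‖x‖ 1 with h | h
    · have h1 := B.le_diag one_pos x
      rw [Real.one_rpow] at h1
      refine h1.trans ?_
      simp only [hg]
      rw [mul_assoc]
      gcongr
      calc (1 : ℝ) = 1 ^ (-((d : ℝ) + α)) := by simp
        _ = 2 ^ ((d : ℝ) + α) * (2 * 1) ^ (-((d : ℝ) + α)) := e 1 one_pos
        _ ≤ _ := by
          gcongr 2 ^ ((d : ℝ) + α) * ?_
          exact Real.rpow_le_rpow_of_nonpos (by positivity) (by linarith) hneg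
    · have hr : 0 < ‖x‖ := one_pos.trans_le h
      have h1 := B.le_tail one_pos x (norm_pos_iff.1 hr)
      rw [one_mul] at h1
      refine h1.trans ?_
      simp only [hg]
      rw [mul_assoc]
      gcongr
      rw [e _ hr]
      gcongr 2 ^ ((d : ℝ) + α) * ?_
      exact Real.rpow_le_rpow_of_nonpos (by positivity) (by linarith) hneg
  refine ⟨(∫ x, g x) + 1, by linarith [show 0 ≤ ∫ x, g x from integral_nonneg hg0], fun t ht => ?_⟩
  · set k : ℝ := t ^ α⁻¹ with hk
    have hkpos : 0 < k := by positivity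
    have hgk : Integrable (fun x => g (k⁻¹ • x)) :=
      hgi.comp_smul (inv_ne_zero hkpos.ne')
    calc ∫⁻ x, ENNReal.ofReal (stableDensity d α t x)
        ≤ ∫⁻ x, ENNReal.ofReal ((k ^ d)⁻¹ * g (k⁻¹ • x)) := by
          refine lintegral_mono fun x => ENNReal.ofReal_le_ofReal ?_
          rw [stableDensity_scale hd h0 ht]
          gcongr
          exact hle _
      _ = ENNReal.ofReal (∫ x, (k ^ d)⁻¹ * g (k⁻¹ • x)) := by
          rw [ofReal_integral_eq_lintegral_ofReal (hgk.const_mul _)]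
          exact Eventually.of_forall fun x => mul_nonneg (by positivity) (hg0 _)
      _ = ENNReal.ofReal (∫ x, g x) := by
          rw [integral_const_mul, Measure.integral_comp_smul, finrank_euclideanSpace,
            Fintype.card_fin, abs_of_pos (by positivity), smul_eq_mul]
          congr 1
          rw [inv_pow, inv_inv, ← mul_assoc, inv_mul_cancel₀ (by positivity), one_mul]
      _ ≤ _ := by
          exact ENNReal.ofReal_le_ofReal (by linarith)

/-! ### The three-way split and the integral estimate. -/

/-- Either one of the two factors is comparable with `p_{a+b}(y-x)`, or the jump from `z` to `w`
has length at least a third of `|y-x|`. -/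
lemma StableBounds.trichotomy {d : ℕ} {α C c : ℝ} (h0 : 0 < α) (hC : 0 < C) (hc : 0 < c)
    (B : StableBounds d α C c) {a b : ℝ} (ha : 0 < a) (hb : 0 < b)
    (x z w y : EuclideanSpace ℝ (Fin d)) :
    stableDensity d α a (z - x) ≤ C * c⁻¹ * (2 ^ ((d : ℝ) / α) + 3 ^ ((d : ℝ) + α)) *
        stableDensity d α (a + b) (y - x) ∨
      stableDensity d α b (y - w) ≤ C * c⁻¹ * (2 ^ ((d : ℝ) / α) + 3 ^ ((d : ℝ) + α)) *
        stableDensity d α (a + b) (y - x) ∨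
      (w ≠ z ∧ ‖w - z‖ ^ (-((d : ℝ) + α)) ≤
        3 ^ ((d : ℝ) + α) * c⁻¹ * (stableDensity d α (a + b) (y - x) / (a + b))) := by
  have hτ : 0 < a + b := by positivity
  set P := stableDensity d α (a + b) (y - x)
  have hd0 : (0 : ℝ) ≤ d := by positivity
  rcases le_total (‖y - x‖ ^ α) (a + b) with h | h
  · have hP := B.diag_le hτ _ h
    have key : ∀ t : ℝ, (a + b) / 2 ≤ t → ∀ v, stableDensity d α t v ≤
        C * c⁻¹ * (2 ^ ((d : ℝ) / α) + 3 ^ ((d : ℝ) + α)) * P := by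
      intro t ht v
      have ht0 : 0 < t := lt_of_lt_of_le (by positivity) ht
      calc stableDensity d α t v ≤ C * t ^ (-((d : ℝ) / α)) := B.le_diag ht0 v
        _ ≤ C * ((a + b) / 2) ^ (-((d : ℝ) / α)) := by
          gcongr C * ?_
          apply Real.rpow_le_rpow_of_nonpos (by positivity) ht
          rw [neg_nonpos]; positivity
        _ = C * c⁻¹ * (2 ^ ((d : ℝ) / α)) * (c * (a + b) ^ (-((d : ℝ) / α))) := by
          rw [Real.div_rpow hτ.le (by norm_num), Real.rpow_neg (by norm_num : (0 : ℝ) ≤ 2)]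
          field_simp
        _ ≤ _ := by
          gcongr
          exact le_add_of_nonneg_right (by positivity)
    -- The longer of the two times is at least half the total, so its on-diagonal bound suffices.
    rcases le_total b a with hab | hab
    · exact Or.inl (key a (by linarith) _)
    · exact Or.inr (Or.inl (key b (by linarith) _))
  · have hP := B.tail_le hτ _ h
    have hr : 0 < ‖y - x‖ := by
      by_contra hn
      rw [le_antisymm (not_lt.1 hn) (norm_nonneg _), Real.zero_rpow h0.ne'] at h
      linarith
    have e3 : (‖y - x‖ / 3) ^ (-((d : ℝ) + α)) =
        3 ^ ((d : ℝ) + α) * ‖y - x‖ ^ (-((d : ℝ) + α)) := by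
      rw [Real.div_rpow hr.le (by norm_num), Real.rpow_neg (by norm_num : (0 : ℝ) ≤ 3)]
      field_simp
    have mono : ∀ v : EuclideanSpace ℝ (Fin d), ‖y - x‖ / 3 ≤ ‖v‖ →
        ‖v‖ ^ (-((d : ℝ) + α)) ≤ 3 ^ ((d : ℝ) + α) * ‖y - x‖ ^ (-((d : ℝ) + α)) := by
      intro v hv
      rw [← e3]
      exact Real.rpow_le_rpow_of_nonpos (by positivity) hv (by linarith)
    have key : ∀ t : ℝ, 0 < t → t ≤ a + b → ∀ v : EuclideanSpace ℝ (Fin d), ‖y - x‖ / 3 ≤ ‖v‖ →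
        stableDensity d α t v ≤ C * c⁻¹ * (2 ^ ((d : ℝ) / α) + 3 ^ ((d : ℝ) + α)) * P := by
      intro t ht htτ v hv
      have hv0 : 0 < ‖v‖ := lt_of_lt_of_le (by positivity) hv
      calc stableDensity d α t v ≤ C * (t * ‖v‖ ^ (-((d : ℝ) + α))) :=
            B.le_tail ht v (norm_pos_iff.1 hv0)
        _ ≤ C * ((a + b) * (3 ^ ((d : ℝ) + α) * ‖y - x‖ ^ (-((d : ℝ) + α)))) := by
          gcongr
          exact mono v hv
        _ = C * c⁻¹ * 3 ^ ((d : ℝ) + α) * (c * ((a + b) * ‖y - x‖ ^ (-((d : ℝ) + α)))) := by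
          field_simp
        _ ≤ _ := by
          gcongr
          exact le_add_of_nonneg_left (by positivity)
    -- By the triangle inequality one of the three displacements is at least `|y-x|/3`.
    by_cases h1 : ‖y - x‖ / 3 ≤ ‖z - x‖
    · exact Or.inl (key a ha (by linarith) _ h1)
    by_cases h2 : ‖y - x‖ / 3 ≤ ‖y - w‖
    · exact Or.inr (Or.inl (key b hb (by linarith) _ h2))
    have h3 : ‖y - x‖ / 3 ≤ ‖w - z‖ := by
      have e : y - x = (y - w) + (w - z) + (z - x) := by abel
      have := norm_add₃_le (a := y - w) (b := w - z) (c := z - x)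
      rw [← e] at this
      push Not at h1 h2
      linarith
    refine Or.inr (Or.inr ⟨?_, ?_⟩)
    · rw [← sub_ne_zero, ← norm_pos_iff]
      exact lt_of_lt_of_le (by positivity) h3
    · refine (mono _ h3).trans ?_
      rw [mul_assoc]
      gcongr
      rw [le_inv_mul_iff₀ hc, le_div_iff₀ hτ]
      linarith

/-- Adding the three alternatives avoids partitioning space. Only the third spends the pointwise
bound on `J`; there `w ≠ z` lets the extended power be read as a real one. -/
lemma StableBounds.integrand_le {d : ℕ} {α C c : ℝ} (h0 : 0 < α) (hC : 0 < C) (hc : 0 < c)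
    (B : StableBounds d α C c) {a b : ℝ} (ha : 0 < a) (hb : 0 < b)
    (x z w y : EuclideanSpace ℝ (Fin d)) {ε : ℝ} (hε : 0 < ε) {J : ℝ≥0∞}
    (hJ : J ≤ ENNReal.ofReal ε * ‖w - z‖ₑ ^ (-(d : ℝ) - α)) :
    ENNReal.ofReal (stableDensity d α a (z - x)) * J *
        ENNReal.ofReal (stableDensity d α b (y - w)) ≤
      ENNReal.ofReal (C * c⁻¹ * (2 ^ ((d : ℝ) / α) + 3 ^ ((d : ℝ) + α)) *
          stableDensity d α (a + b) (y - x)) *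
        (J * ENNReal.ofReal (stableDensity d α b (y - w))) +
      ENNReal.ofReal (C * c⁻¹ * (2 ^ ((d : ℝ) / α) + 3 ^ ((d : ℝ) + α)) *
          stableDensity d α (a + b) (y - x)) *
        (ENNReal.ofReal (stableDensity d α a (z - x)) * J) +
      ENNReal.ofReal (ε * (3 ^ ((d : ℝ) + α) * c⁻¹ *
          (stableDensity d α (a + b) (y - x) / (a + b)))) *
        (ENNReal.ofReal (stableDensity d α a (z - x)) *
          ENNReal.ofReal (stableDensity d α b (y - w))) := by
  rcases B.trichotomy h0 hC hc ha hb x z w y with h | h | ⟨hwz, h⟩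
  · refine le_trans ?_ (le_trans le_self_add le_self_add)
    rw [mul_assoc]
    gcongr
  · refine le_trans ?_ (le_trans le_add_self le_self_add)
    rw [mul_comm (ENNReal.ofReal (stableDensity d α a (z - x)) * J)]
    gcongr
  · refine le_trans ?_ le_add_self
    have hn : 0 < ‖w - z‖ := norm_pos_iff.2 (sub_ne_zero.2 hwz)
    have hJ' : J ≤ ENNReal.ofReal (ε * (3 ^ ((d : ℝ) + α) * c⁻¹ *
        (stableDensity d α (a + b) (y - x) / (a + b)))) := by
      refine hJ.trans ?_
      rw [← ofReal_norm, ENNReal.ofReal_rpow_of_pos hn, ← ENNReal.ofReal_mul hε.le, ← neg_add']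
      exact ENNReal.ofReal_le_ofReal (by gcongr)
    calc _ = J * (ENNReal.ofReal (stableDensity d α a (z - x)) *
          ENNReal.ofReal (stableDensity d α b (y - w))) := by ring
      _ ≤ _ := by gcongr

lemma lintegral_kernel_le_left {d : ℕ}
    (j : EuclideanSpace ℝ (Fin d) → EuclideanSpace ℝ (Fin d) → ℝ≥0∞) (z) :
    ∫⁻ w, j z w ≤ kernelNorm d j :=
  (le_iSup (fun z => ∫⁻ w, j z w) z).trans (le_max_left _ _)

lemma lintegral_kernel_le_right {d : ℕ}
    (j : EuclideanSpace ℝ (Fin d) → EuclideanSpace ℝ (Fin d) → ℝ≥0∞) (w) :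
    ∫⁻ z, j z w ≤ kernelNorm d j :=
  (le_iSup (fun w => ∫⁻ z, j z w) w).trans (le_max_right _ _)

lemma lintegral_const_mul_add_add {X : Type*} [MeasurableSpace X] {μ : Measure X}
    {f g h : X → ℝ≥0∞} (hf : Measurable f) (hg : Measurable g) (hh : Measurable h)
    (A B D : ℝ≥0∞) :
    ∫⁻ x, (A * f x + B * g x + D * h x) ∂μ =
      A * ∫⁻ x, f x ∂μ + B * ∫⁻ x, g x ∂μ + D * ∫⁻ x, h x ∂μ := by
  rw [lintegral_add_right _ (hh.const_mul D), lintegral_add_right _ (hg.const_mul B),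
    lintegral_const_mul _ hf, lintegral_const_mul _ hg, lintegral_const_mul _ hh]

/-- A form bound for a kernel `Φ(z,w)` dominated by `A j q + A p j + D p q`. -/
lemma lintegral_lintegral_le_kernelNorm {d : ℕ}
    {j : EuclideanSpace ℝ (Fin d) → EuclideanSpace ℝ (Fin d) → ℝ≥0∞}
    (hj : Measurable (Function.uncurry j)) {p q : EuclideanSpace ℝ (Fin d) → ℝ≥0∞}
    (hp : Measurable p) (hq : Measurable q) {A D K : ℝ≥0∞}
    (hpK : ∫⁻ z, p z ≤ K) (hqK : ∫⁻ w, q w ≤ K) :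
    ∫⁻ z, ∫⁻ w, (A * (j z w * q w) + A * (p z * j z w) + D * (p z * q w)) ≤
      2 * A * kernelNorm d j * K + D * K ^ 2 := by
  have hjz : ∀ z, Measurable (j z) := fun z => hj.comp measurable_prodMk_left
  have hjw : ∀ w, Measurable (fun z => j z w) := fun w => hj.comp measurable_prodMk_right
  have m1 : Measurable (fun v : EuclideanSpace ℝ (Fin d) × EuclideanSpace ℝ (Fin d) =>
      j v.1 v.2 * q v.2) := hj.mul (hq.comp measurable_snd)
  have m2 : Measurable (fun v : EuclideanSpace ℝ (Fin d) × EuclideanSpace ℝ (Fin d) =>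
      p v.1 * j v.1 v.2) := (hp.comp measurable_fst).mul hj
  have t1 : ∫⁻ z, ∫⁻ w, j z w * q w ≤ kernelNorm d j * K := by
    -- The weight depends on `w`, so `j` is integrated in `z` first; the next term needs the other
    -- supremum in `kernelNorm`.
    rw [lintegral_lintegral_swap m1.aemeasurable]
    calc _ = ∫⁻ w, (∫⁻ z, j z w) * q w :=
          lintegral_congr fun w => lintegral_mul_const _ (hjw w)
      _ ≤ ∫⁻ w, kernelNorm d j * q w := by
          gcongr with w
          exact lintegral_kernel_le_right j w
      _ = kernelNorm d j * ∫⁻ w, q w := lintegral_const_mul _ hq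
      _ ≤ _ := by gcongr
  have t2 : ∫⁻ z, ∫⁻ w, p z * j z w ≤ kernelNorm d j * K := by
    calc _ = ∫⁻ z, p z * ∫⁻ w, j z w :=
          lintegral_congr fun z => lintegral_const_mul _ (hjz z)
      _ ≤ ∫⁻ z, p z * kernelNorm d j := by
          gcongr with z
          exact lintegral_kernel_le_left j z
      _ = (∫⁻ z, p z) * kernelNorm d j := lintegral_mul_const _ hp
      _ ≤ K * kernelNorm d j := by gcongr
      _ = _ := mul_comm _ _
  have t3 : ∫⁻ z, ∫⁻ w, p z * q w ≤ K * K := by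
    calc _ = ∫⁻ z, p z * ∫⁻ w, q w := lintegral_congr fun z => lintegral_const_mul _ hq
      _ = (∫⁻ z, p z) * ∫⁻ w, q w := lintegral_mul_const _ hp
      _ ≤ _ := by gcongr
  have i1 : ∀ z, Measurable (fun w => j z w * q w) := fun z => (hjz z).mul hq
  have i2 : ∀ z, Measurable (fun w => p z * j z w) := fun z => (hjz z).const_mul _
  have i3 : ∀ z, Measurable (fun w => p z * q w) := fun z => hq.const_mul _
  calc _ = ∫⁻ z, (A * (∫⁻ w, j z w * q w) + A * (∫⁻ w, p z * j z w) + D * ∫⁻ w, p z * q w) := by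
        exact lintegral_congr fun z => lintegral_const_mul_add_add (i1 z) (i2 z) (i3 z) A A D
    _ = A * (∫⁻ z, ∫⁻ w, j z w * q w) + A * (∫⁻ z, ∫⁻ w, p z * j z w) +
        D * ∫⁻ z, ∫⁻ w, p z * q w := by
        have m3 : Measurable (fun v : EuclideanSpace ℝ (Fin d) × EuclideanSpace ℝ (Fin d) =>
          p v.1 * q v.2) := (hp.comp measurable_fst).mul (hq.comp measurable_snd)
        exact lintegral_const_mul_add_add m1.lintegral_prod_right' m2.lintegral_prod_right'
          m3.lintegral_prod_right' A A D
    _ ≤ A * (kernelNorm d j * K) + A * (kernelNorm d j * K) + D * (K * K) := by gcongr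
    _ = _ := by ring

end StableKernel

/-! ### Assembly. -/

theorem lemma4 (d : ℕ) (hd : 0 < d) (α : ℝ) (hα₀ : 0 < α) (hα₂ : α < 2) :
    ∃ C₁ C₂ : ℝ, 0 < C₁ ∧ 0 < C₂ ∧
      ∀ ε : ℝ, 0 < ε → C₁ * 3 ^ ((d : ℝ) + α) * ε < 1 →
      ∀ j : EuclideanSpace ℝ (Fin d) → EuclideanSpace ℝ (Fin d) → ℝ≥0∞,
        Measurable (Function.uncurry j) →
        StableKernel.kernelNorm d j < ∞ →
        (∀ z w, j z w ≤ ENNReal.ofReal ε * ‖w - z‖ₑ ^ (-(d : ℝ) - α)) →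
        ∃ η c : ℝ, 0 ≤ η ∧ η < 1 ∧ 0 ≤ c ∧
          η = C₁ * 3 ^ ((d : ℝ) + α) * ε ∧
          c = C₂ * (StableKernel.kernelNorm d j).toReal ∧
          ∀ s t : ℝ, s < t → ∀ x y : EuclideanSpace ℝ (Fin d),
            ∫⁻ u in Set.Ioo s t, ∫⁻ z, ∫⁻ w,
              ENNReal.ofReal (StableKernel.transitionDensity d α s x u z) * j z w *
                ENNReal.ofReal (StableKernel.transitionDensity d α u w t y)
              ≤ ENNReal.ofReal ((η + c * (t - s)) *
                  StableKernel.transitionDensity d α s x t y) := by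
  open StableKernel in
  obtain ⟨C, c, hC, hc, B⟩ := exists_stableBounds hd hα₀ hα₂
  obtain ⟨K, hK, hKle⟩ := exists_lintegral_stableDensity_le hd hα₀ hC B
  set A : ℝ := C * c⁻¹ * (2 ^ ((d : ℝ) / α) + 3 ^ ((d : ℝ) + α)) with hA
  have hApos : 0 < A := by positivity
  -- `C₁` comes from the long-jump term, with one `K` per density; `C₂` collects the two terms in
  -- which one density is replaced by `A * P`.
  refine ⟨c⁻¹ * K ^ 2, 2 * A * K, by positivity, by positivity,
    fun ε hε hη j hj hjfin hjle => ⟨_, _, by positivity, hη, by positivity, rfl, rfl, ?_⟩⟩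
  intro s t hst x y
  unfold transitionDensity
  have hτ : 0 < t - s := sub_pos.2 hst
  set P := stableDensity d α (t - s) (y - x) with hP
  have hP0 : 0 ≤ P := B.nonneg hc hτ _
  set N := (kernelNorm d j).toReal with hN
  have hNj : kernelNorm d j = ENNReal.ofReal N := (ENNReal.ofReal_toReal hjfin.ne).symm
  set D : ℝ := ε * (3 ^ ((d : ℝ) + α) * c⁻¹ * (P / (t - s))) with hD
  have hD0 : 0 ≤ D := by positivity
  -- The bound does not depend on `u`, so integrating in time multiplies by `t - s`, which cancels
  -- the denominator in `D`.
  have inner_le : ∀ u ∈ Set.Ioo s t, ∫⁻ z, ∫⁻ w,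
      ENNReal.ofReal (stableDensity d α (u - s) (z - x)) * j z w *
        ENNReal.ofReal (stableDensity d α (t - u) (y - w)) ≤
      ENNReal.ofReal (2 * (A * P) * N * K + D * K ^ 2) := by
    intro u hu
    have ha : 0 < u - s := sub_pos.2 hu.1
    have hb : 0 < t - u := sub_pos.2 hu.2
    have hab : (u - s) + (t - u) = t - s := by ring
    have hma := (measurable_stableDensity hd hα₀ ha).ennreal_ofReal
    have hmb := (measurable_stableDensity hd hα₀ hb).ennreal_ofReal
    calc _ ≤ ∫⁻ z, ∫⁻ w, (ENNReal.ofReal (A * P) *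
              (j z w * ENNReal.ofReal (stableDensity d α (t - u) (y - w))) +
            ENNReal.ofReal (A * P) *
              (ENNReal.ofReal (stableDensity d α (u - s) (z - x)) * j z w) +
            ENNReal.ofReal D * (ENNReal.ofReal (stableDensity d α (u - s) (z - x)) *
              ENNReal.ofReal (stableDensity d α (t - u) (y - w)))) := by
          refine lintegral_mono fun z => lintegral_mono fun w => ?_
          have h := B.integrand_le hα₀ hC hc ha hb x z w y hε (hjle z w)
          rwa [hab] at h
      _ ≤ 2 * ENNReal.ofReal (A * P) * kernelNorm d j * ENNReal.ofReal K +
            ENNReal.ofReal D * ENNReal.ofReal K ^ 2 := by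
          refine lintegral_lintegral_le_kernelNorm hj
            (p := fun z => ENNReal.ofReal (stableDensity d α (u - s) (z - x)))
            (q := fun w => ENNReal.ofReal (stableDensity d α (t - u) (y - w)))
            (hma.comp (by fun_prop)) (hmb.comp (by fun_prop)) ?_ ?_
          · rw [lintegral_sub_right_eq_self
              (fun z => ENNReal.ofReal (stableDensity d α (u - s) z)) x]
            exact hKle _ ha
          · rw [lintegral_sub_left_eq_self
              (fun z => ENNReal.ofReal (stableDensity d α (t - u) z)) y]
            exact hKle _ hb
      _ = _ := by
          rw [hNj, ENNReal.ofReal_add (by positivity) (by positivity),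
            ENNReal.ofReal_mul (p := 2 * (A * P) * N) (by positivity),
            ENNReal.ofReal_mul (p := 2 * (A * P)) (by positivity),
            ENNReal.ofReal_mul (p := 2) (by norm_num), ENNReal.ofReal_mul (p := D) hD0,
            ENNReal.ofReal_pow hK.le,
            ENNReal.ofReal_ofNat]
  calc _ ≤ ∫⁻ u in Set.Ioo s t, ENNReal.ofReal (2 * (A * P) * N * K + D * K ^ 2) :=
        setLIntegral_mono measurable_const inner_le
    _ = ENNReal.ofReal ((2 * (A * P) * N * K + D * K ^ 2) * (t - s)) := by
        rw [setLIntegral_const, Real.volume_Ioo, ← ENNReal.ofReal_mul (by positivity)]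
    _ = _ := by
        congr 1
        rw [hD]
        field_simp
        ring
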